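/- A mixed graph $\mathcal G$ over a finite vertex set $\mathbf W$ has a set of directed edges $X\to Y$ and a set of bidirected edges $X\leftrightarrow Y$ between vertices of $\mathbf W$; two vertices are neighbors if some edge joins them. For $\mathbf W'\subseteq\mathbf W$, $\mathcal G[\mathbf W']$ denotes the induced subgraph. $X$ is an ancestor of $Y$ if $X=Y$ or there is a directed path from $X$ to $Y$. A path is a sequence of distinct vertices in which consecutive vertices are neighbors; a non-endpoint vertex is a collider on the path if the edges to its predecessor and its successor on the path both have an arrowhead at it. For distinct $X,Y$ and $\mathbf Z\subseteq\mathbf W\setminus\{X,Y\}$, a path between $X$ and $Y$ is blocked by $\mathbf Z$ if it has a collider that is not an ancestor of any member of $\mathbf Z\cup\{X,Y\}$, or a non-endpoint non-collider that belongs to $\mathbf Z$; $\mathbf Z$ m-separates $X$ and $Y$ in $\mathcal G$ if it blocks every path between them. $\mathcal G$ is a maximal ancestral graph (MAG) if no edge $X\to Y$ or $X\leftrightarrow Y$ exists with $Y$ an ancestor of $X$, and every two distinct non-neighbors are m-separated by some set. Two MAGs over the same vertex set are Markov equivalent if they have the same m-separations, that is, for all distinct $X,Y$ and all $\mathbf Z\subseteq\mathbf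 W\setminus\{X,Y\}$, $\mathbf Z$ m-separates $X$ and $Y$ in one if and only if it does so in the other. A vertex $X$ of a MAG $\mathcal G$ over $\mathbf W$ is removable if, for all distinct $Y,T\in\mathbf W\setminus\{X\}$ and all $\mathbf Z\subseteq\mathbf W\setminus\{X,Y,T\}$, $\mathbf Z$ m-separates $Y$ and $T$ in $\mathcal G$ if and only if it does so in $\mathcal G[\mathbf W\setminus\{X\}]$. An ordering $(X_1,\dots,X_n)$ of all vertices of $\mathcal G$ is an r-order of $\mathcal G$ if, for each $1\le i\le n$, $X_i$ is removable in $\mathcal G[\{X_i,X_{i+1},\dots,X_n\}]$. **Proposition.** Let $\mathcal G_1$ and $\mathcal G_2$ be Markov equivalent MAGs over the same finite vertex set. Then $\mathcal G_1$ and $\mathcal G_2$ have the same set of removable vertices, and they have the same set of r-orders. -/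

import Mathlib

/-- A mixed graph with vertex set `V`: a set of directed edges (`dir X Y` is `X → Y`) and a set of
bidirected edges (`bidir X Y` is `X ↔ Y`, an unordered pair). -/
structure MixedGraph (V : Type*) where
  dir : V → V → Prop
  bidir : V → V → Prop
  bidir_symm : ∀ X Y, bidir X Y → bidir Y X

namespace MixedGraph

variable {V : Type*}

/-- The induced subgraph over `W`. -/
def induce (G : MixedGraph V) (W : Set V) : MixedGraph W where
  dir X Y := G.dir X Y
  bidir X Y := G.bidir X Y
  bidir_symm X Y h := G.bidir_symm X Y h

/-- Two variables are neighbors if a directed or bidirected edge exists between them. -/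
def Neighbor (G : MixedGraph V) (X Y : V) : Prop :=
  G.dir X Y ∨ G.dir Y X ∨ G.bidir X Y

/-- The skeleton, an undirected simple graph. (Loops are irrelevant to paths, whose vertices are
pairwise distinct, and ancestral graphs have none.) -/
def skeleton (G : MixedGraph V) : SimpleGraph V where
  Adj X Y := X ≠ Y ∧ G.Neighbor X Y
  symm := ⟨fun _ _ h =>
    ⟨h.1.symm, h.2.elim (fun h => Or.inr (Or.inl h))
      (fun h => h.elim Or.inl (fun h => Or.inr (Or.inr (G.bidir_symm _ _ h))))⟩⟩
  loopless := ⟨fun _ h => h.1 rfl⟩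

/-- `X` is an ancestor of `Y`: there is a directed path, possibly of length zero, from `X` to
`Y`. -/
def IsAncestor (G : MixedGraph V) (X Y : V) : Prop :=
  Relation.ReflTransGen G.dir X Y

/-- The set of ancestors of the members of `S`. -/
def anc (G : MixedGraph V) (S : Set V) : Set V :=
  {X | ∃ Y ∈ S, G.IsAncestor X Y}

/-- There is an edge between `U` and `W` with an arrowhead at `W`: `U → W` or `U ↔ W`. -/
def ArrowInto (G : MixedGraph V) (U W : V) : Prop :=
  G.dir U W ∨ G.bidir U W

/-- `W` is a collider between its predecessor `U` and its successor `T` on a path. -/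
def IsCollider (G : MixedGraph V) (U W T : V) : Prop :=
  G.ArrowInto U W ∧ G.ArrowInto T W

/-- The path `p` between `X` and `Y` is blocked by `Z`: some non-endpoint vertex `W` of `p`, with
predecessor `U` and successor `T` on `p`, is a collider on `p` outside the ancestors of
`Z ∪ {X, Y}`, or is a non-collider on `p` in `Z`. -/
def Blocked (G : MixedGraph V) {X Y : V} (p : G.skeleton.Path X Y) (Z : Set V) : Prop :=
  ∃ U W T : V, [U, W, T] <:+: p.1.support ∧
    ((G.IsCollider U W T ∧ W ∉ G.anc (Z ∪ {X, Y})) ∨ (¬ G.IsCollider U W T ∧ W ∈ Z))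

/-- `Z` m-separates `X` and `Y` (used for `X ≠ Y` and `Z` containing neither of them). -/
def MSep (G : MixedGraph V) (X Y : V) (Z : Set V) : Prop :=
  ∀ p : G.skeleton.Path X Y, G.Blocked p Z

/-- No directed cycles and no almost directed cycles. -/
def IsAncestral (G : MixedGraph V) : Prop :=
  (∀ X Y, G.dir X Y → ¬ G.IsAncestor Y X) ∧ (∀ X Y, G.bidir X Y → ¬ G.IsAncestor Y X)

/-- Every pair of distinct non-neighbors is m-separable. -/
def IsMaximal (G : MixedGraph V) : Prop :=
  ∀ X Y, X ≠ Y → ¬ G.Neighbor X Y → ∃ Z : Set V, X ∉ Z ∧ Y ∉ Z ∧ G.MSep X Y Z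

/-- Maximal ancestral graphs. -/
def IsMAG (G : MixedGraph V) : Prop :=
  G.IsAncestral ∧ G.IsMaximal

/-- `G₁` and `G₂` impose the same m-separations. -/
def MarkovEquivalent (G₁ G₂ : MixedGraph V) : Prop :=
  ∀ X Y : V, X ≠ Y → ∀ Z : Set V, X ∉ Z → Y ∉ Z → (G₁.MSep X Y Z ↔ G₂.MSep X Y Z)

/-- `X` is removable in `G`: `G` and its induced subgraph over the vertices other than `X` impose
the same m-separations over those vertices. -/
def IsRemovable (G : MixedGraph V) (X : V) : Prop :=
  ∀ Y T : ({X}ᶜ : Set V), Y ≠ T → ∀ Z : Set ({X}ᶜ : Set V), Y ∉ Z → T ∉ Z →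
    (G.MSep (Y : V) (T : V) (Subtype.val '' Z) ↔ (G.induce {X}ᶜ).MSep Y T Z)

/-- The set of removable vertices. -/
def removables (G : MixedGraph V) : Set V :=
  {X | G.IsRemovable X}

/-- The r-orders of `G`: the orders `(π 0, π 1, …)` of the (finitely many) vertices in which every
`π i` is removable in the induced subgraph over `π i` and the vertices after it. -/
def rOrders (G : MixedGraph V) : Set (Fin (Nat.card V) ≃ V) :=
  {π | ∀ i, (G.induce {v | ∃ j, i ≤ j ∧ π j = v}).IsRemovable ⟨π i, i, le_rfl, rfl⟩}

end MixedGraph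

/-!
A vertex `X` of a maximal ancestral graph is removable if and only if every two distinct
non-neighbors other than `X` are m-separated by a set avoiding `X` (`isRemovable_iff_separable`).
Neighbors are exactly the pairs that no set m-separates, so this criterion speaks about
m-separations only and is shared by Markov equivalent graphs. Once `X` is removed, the two induced
subgraphs are again Markov equivalent MAGs, and induction along an order treats the r-orders.

Passing to an induced subgraph never destroys an m-separation (`MSep.comap`), which gives one
direction of the criterion. For the other, an `X`-avoiding set `Z` and a walk from `A` to `B` in `G`
open given `Z` are turned into an open walk avoiding `X`. Call a walk between `C` and `D`
*inducing* if its inner vertices are ancestors of `C` or `D` and are colliders unless equal to `X`.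
It is open given any set avoiding `X`, so its distinct endpoints are neighbors under the
criterion. The given walk is decomposed into inducing walks between vertices other than `X`:
a passage `U, X, W` is one of them if `X` is a non-collider, and if `X` is a collider it is split as
`U, X, Y` and `Y, X, W`, where `Y` is a child of `X` that is an ancestor of `Z ∪ {A, B}`. Replacing
each inducing walk by the edge between its endpoints may turn a collider `v ∈ Z` between
two of them into a non-collider, but then `v` is an ancestor of one of the vertices next to it in the
decomposition, and the two walks merge into a single inducing walk (`SegmentChain.hop`).
Iterating the merge leaves edges which form an open walk avoiding `X`.

Open walks may be used in place of open paths (`Trail.exists_path`): all vertices of an open walk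
are ancestors of `Z ∪ {A, B}`, so cutting out a closed subwalk keeps the walk open.
-/

namespace MixedGraph

/-! ### Open trails -/

section Trails

variable {V : Type*}

/-- The vertex `v`, entered from `u` and left to `w`, is passable: it lies in `M`, and outside `Z`
unless it is a collider. Here `M` is a set of ancestors, which for open walks contains the
non-colliders as well. -/
def OpenAt (G : MixedGraph V) (M Z : Set V) (u v w : V) : Prop :=
  v ∈ M ∧ (¬ G.IsCollider u v w → v ∉ Z)

/-- `G.Trail P A a b B`: there is a walk from `A` to `B` in the skeleton, with at least one edge,
whose second vertex is `a` and whose last but one is `b`, such that `P u v w` holds for any three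
consecutive vertices `u, v, w`. -/
inductive Trail (G : MixedGraph V) (P : V → V → V → Prop) : V → V → V → V → Prop
  | edge {v w : V} : G.skeleton.Adj v w → Trail G P v w v w
  | snoc {v a b w x : V} : Trail G P v a b w → P b w x → G.skeleton.Adj w x →
      Trail G P v a w x

variable {G : MixedGraph V}

theorem Trail.mono {P Q : V → V → V → Prop} (h : ∀ u v w, P u v w → Q u v w)
    {A a b B : V} (t : G.Trail P A a b B) : G.Trail Q A a b B := by
  induction t with
  | edge e => exact .edge e
  | snoc _ hp e ih => exact .snoc ih (h _ _ _ hp) e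

theorem Trail.append {P : V → V → V → Prop} {u a b v c d w : V} (t : G.Trail P u a b v)
    (s : G.Trail P v c d w) (h : P b v c) : G.Trail P u a d w := by
  induction s with
  | edge e => exact .snoc t h e
  | snoc _ hp e ih => exact .snoc ih hp e

theorem Trail.map {U : Type*} {H : MixedGraph U} {P : U → U → U → Prop} {Q : V → V → V → Prop}
    (f : U → V) (hadj : ∀ u v, H.skeleton.Adj u v → G.skeleton.Adj (f u) (f v))
    (hP : ∀ u v w, P u v w → Q (f u) (f v) (f w)) {A a b B : U} (t : H.Trail P A a b B) :
    G.Trail Q (f A) (f a) (f b) (f B) := by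
  induction t with
  | edge e => exact .edge (hadj _ _ e)
  | snoc _ hp e ih => exact .snoc ih (hP _ _ _ hp) (hadj _ _ e)

theorem OpenAt.mono {M M' Z Z' : Set V} (hM : M ⊆ M') (hZ : Z' ⊆ Z) {u v w : V}
    (h : G.OpenAt M Z u v w) : G.OpenAt M' Z' u v w :=
  ⟨hM h.1, fun hc hz => h.2 hc (hZ hz)⟩

/-- Cutting out a closed walk at `v` keeps `v` passable. -/
theorem OpenAt.cut {M Z : Set V} {u v c d f : V} (h₁ : G.OpenAt M Z u v c)
    (h₂ : G.OpenAt M Z d v f) : G.OpenAt M Z u v f := by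
  refine ⟨h₁.1, fun hc => ?_⟩
  by_cases hu : G.ArrowInto u v
  · exact h₂.2 fun h => hc ⟨hu, h.2⟩
  · exact h₁.2 fun h => hu h.1

theorem dir_of_not_arrowInto {u v : V} (h : G.skeleton.Adj u v) (hn : ¬ G.ArrowInto u v) :
    G.dir v u := by
  rcases h.2 with h | h | h
  · exact absurd (Or.inl h) hn
  · exact h
  · exact absurd (Or.inr h) hn

theorem subset_anc (S : Set V) : S ⊆ G.anc S := fun v hv => ⟨v, hv, .refl⟩

theorem anc_mono {S T : Set V} (h : S ⊆ T) : G.anc S ⊆ G.anc T :=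
  fun _ ⟨y, hy, hv⟩ => ⟨y, h hy, hv⟩

theorem mem_anc_of_isAncestor {S : Set V} {v w : V} (h : G.IsAncestor v w) (hw : w ∈ G.anc S) :
    v ∈ G.anc S := by
  obtain ⟨y, hy, hwy⟩ := hw
  exact ⟨y, hy, h.trans hwy⟩

/-- Following the walk from the arrow `v → w` on, the arrows keep pointing ahead until a collider
or the end `B` is reached, of which `v` is therefore an ancestor. -/
theorem mem_anc_of_dir_walk {S : Set V} {w B : V} (p : G.skeleton.Walk w B) (hB : B ∈ G.anc S)
    (v : V) (hvw : G.dir v w)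
    (hp : ∀ U W T, [U, W, T] <:+: v :: p.support → G.IsCollider U W T → W ∈ G.anc S) :
    v ∈ G.anc S := by
  refine mem_anc_of_isAncestor (.single hvw) ?_
  induction p generalizing v with
  | nil => exact hB
  | @cons w x _ e q ih =>
    by_cases hx : G.ArrowInto x w
    · refine hp v w x ?_ ⟨Or.inl hvw, hx⟩
      rw [SimpleGraph.Walk.support_cons, ← q.cons_tail_support]
      exact ⟨[], q.support.tail, rfl⟩
    · have hd := dir_of_not_arrowInto e.symm hx
      refine mem_anc_of_isAncestor (.single hd) (ih hB w hd fun U W T h => hp U W T ?_)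
      rw [SimpleGraph.Walk.support_cons]
      exact h.trans (List.suffix_cons _ _).isInfix

/-- An unblocked walk from `v` continues a trail that enters `v` from `t`. All its inner vertices
are ancestors of `S`, non-colliders included: an inner vertex is a collider, or has an arrow to its
successor, or has an arrow to its predecessor, and `hv` passes membership on in the last case. -/
theorem Trail.extend_walk {S Z : Set V} {A a t v B : V} (p : G.skeleton.Walk v B)
    (hB : B ∈ G.anc S) (hv : G.dir v t → v ∈ G.anc S) (hadj : G.skeleton.Adj t v)
    (tr : G.Trail (G.OpenAt (G.anc S) Z) A a t v)
    (hp : ∀ U W T, [U, W, T] <:+: t :: p.support →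
      (G.IsCollider U W T → W ∈ G.anc S) ∧ (¬ G.IsCollider U W T → W ∉ Z)) :
    ∃ b, G.Trail (G.OpenAt (G.anc S) Z) A a b B := by
  induction p generalizing t with
  | nil => exact ⟨t, tr⟩
  | @cons v w _ e q ih =>
    have hp' : ∀ U W T, [U, W, T] <:+: v :: q.support →
        (G.IsCollider U W T → W ∈ G.anc S) ∧ (¬ G.IsCollider U W T → W ∉ Z) := by
      refine fun U W T h => hp U W T ?_
      rw [SimpleGraph.Walk.support_cons]
      exact h.trans (List.suffix_cons _ _).isInfix
    have htri : [t, v, w] <:+: t :: (SimpleGraph.Walk.cons e q).support := by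
      rw [SimpleGraph.Walk.support_cons, ← q.cons_tail_support]
      exact ⟨[], q.support.tail, rfl⟩
    have hvM : v ∈ G.anc S := by
      by_cases h₁ : G.ArrowInto t v
      · by_cases h₂ : G.ArrowInto w v
        · exact (hp _ _ _ htri).1 ⟨h₁, h₂⟩
        · exact mem_anc_of_dir_walk q hB v (dir_of_not_arrowInto e.symm h₂)
            fun U W T h => (hp' U W T h).1
      · exact hv (dir_of_not_arrowInto hadj h₁)
    exact ih hB (fun hd => mem_anc_of_isAncestor (.single hd) hvM) e
      (tr.snoc ⟨hvM, (hp _ _ _ htri).2⟩ e) hp'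

theorem exists_trail_of_not_mSep {A B : V} {Z : Set V} (hAB : A ≠ B) (h : ¬ G.MSep A B Z) :
    ∃ a b, G.Trail (G.OpenAt (G.anc (Z ∪ {A, B})) Z) A a b B := by
  simp only [MSep, not_forall] at h
  obtain ⟨⟨p, hpath⟩, hp⟩ := h
  have hp' : ∀ U W T, [U, W, T] <:+: p.support →
      (G.IsCollider U W T → W ∈ G.anc (Z ∪ {A, B})) ∧ (¬ G.IsCollider U W T → W ∉ Z) := by
    intro U W T hi
    constructor
    · intro hc
      by_contra hW
      exact hp ⟨U, W, T, hi, Or.inl ⟨hc, hW⟩⟩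
    · intro hc hW
      exact hp ⟨U, W, T, hi, Or.inr ⟨hc, hW⟩⟩
  have hA : A ∈ G.anc (Z ∪ {A, B}) := subset_anc _ (by simp)
  have hB : B ∈ G.anc (Z ∪ {A, B}) := subset_anc _ (by simp)
  cases p with
  | nil => exact absurd rfl hAB
  | @cons _ w _ e q =>
    exact ⟨w, Trail.extend_walk q hB (fun hd => mem_anc_of_isAncestor (.single hd) hA) e (.edge e)
      (by simpa only [SimpleGraph.Walk.support_cons] using hp')⟩

/-- A trail can be shortened to a path, provided that the condition on triples survives cutting
out closed subwalks. The path may enter its end `B` from another vertex than the trail; the last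
conjunct says that every continuation of the trail is a continuation of the path. -/
theorem Trail.exists_path {P : V → V → V → Prop}
    (hcut : ∀ u v c d f, P u v c → P d v f → P u v f) {A a b B : V} (t : G.Trail P A a b B) :
    ∃ p : G.skeleton.Walk A B, p.IsPath ∧
      (∀ U W T, [U, W, T] <:+: p.support → P U W T) ∧
      ∀ f, P b B f → ∀ u, [u, B] <:+ p.support → P u B f := by
  classical
  induction t with
  | edge e =>
    refine ⟨.cons e .nil, by simpa using e.ne, fun U W T h => ?_, fun f hf u hu => ?_⟩
    · have := h.length_le
      simp at this
    · have := hu.eq_of_length (by simp)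
      simp only [SimpleGraph.Walk.support_cons, SimpleGraph.Walk.support_nil,
        List.cons.injEq] at this
      rw [this.1]
      exact hf
  | @snoc b w x _ hP e ih =>
    obtain ⟨p, hpath, htri, hend⟩ := ih
    have hlast : ∀ y, [y] <:+ p.support → y = w := by
      rintro y ⟨l, hl⟩
      have := p.getLast_support
      simp only [← hl, List.getLast_append_singleton] at this
      exact this
    by_cases hx : x ∈ p.support
    · refine ⟨p.takeUntil x hx, hpath.takeUntil hx, fun U W T h => htri U W T ?_,
        fun f hf u hu => ?_⟩
      · exact h.trans (SimpleGraph.Walk.isSubwalk_iff_support_isInfix.1 (p.isSubwalk_takeUntil hx))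
      · -- the path leaves `x` towards some `y`, and the closed walk from `x` to `x` is cut out
        have hsupp : p.support = (p.takeUntil x hx).support ++ (p.dropUntil x hx).support.tail := by
          rw [← SimpleGraph.Walk.support_append, SimpleGraph.Walk.take_spec]
        obtain ⟨l, hl⟩ := hu
        cases hq : p.dropUntil x hx with
        | nil => exact absurd rfl e.ne
        | @cons _ y _ e' q =>
          rw [hq, SimpleGraph.Walk.support_cons, List.tail_cons, ← q.cons_tail_support,
            ← hl] at hsupp
          exact hcut _ _ _ _ _ (htri u x y ⟨l, q.support.tail, by simp [hsupp]⟩) hf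
    · refine ⟨p.concat e, hpath.concat hx e, fun U W T h => ?_, fun f hf u hu => ?_⟩
      · rw [SimpleGraph.Walk.support_concat] at h
        rcases List.infix_concat_iff.1 h with ⟨l, hl⟩ | h
        · obtain ⟨hl', hT⟩ := List.append_inj' (s₁ := l ++ [U, W]) (t₁ := [T])
            (s₂ := p.support) (t₂ := [x]) (by simpa using hl) rfl
          obtain rfl := List.singleton_inj.1 hT
          obtain rfl := hlast W ⟨l ++ [U], by simpa using hl'⟩
          exact hend _ hP U ⟨l, hl'⟩
        · exact htri _ _ _ h
      · rw [SimpleGraph.Walk.support_concat] at hu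
        obtain ⟨l, hl⟩ := hu
        have := (List.append_inj' (s₁ := l ++ [u]) (t₁ := [x]) (s₂ := p.support) (t₂ := [x])
          (by simpa using hl) rfl).1
        obtain rfl := hlast u ⟨l, this⟩
        exact hf

theorem not_mSep_of_trail {A a b B : V} {Z : Set V}
    (t : G.Trail (G.OpenAt (G.anc (Z ∪ {A, B})) Z) A a b B) : ¬ G.MSep A B Z := by
  intro h
  obtain ⟨p, hpath, hp, -⟩ := t.exists_path fun _ _ _ _ _ h₁ h₂ => h₁.cut h₂
  obtain ⟨U, W, T, hi, ⟨-, hW⟩ | ⟨hc, hW⟩⟩ := h ⟨p, hpath⟩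
  · exact hW (hp U W T hi).1
  · exact (hp U W T hi).2 hc hW

end Trails

/-! ### Induced subgraphs -/

section Comap

variable {U V : Type*}

/-- The mixed graph on `U` pulled back along `f : U → V`; the induced subgraph over `W` is the
case of the inclusion of `W`. -/
def comap (G : MixedGraph V) (f : U → V) : MixedGraph U where
  dir X Y := G.dir (f X) (f Y)
  bidir X Y := G.bidir (f X) (f Y)
  bidir_symm _ _ h := G.bidir_symm _ _ h

variable {G : MixedGraph V}

theorem IsAncestor.of_comap {f : U → V} {v w : U} (h : (G.comap f).IsAncestor v w) :
    G.IsAncestor (f v) (f w) :=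
  Relation.ReflTransGen.lift (r := (G.comap f).dir) f (fun _ _ h => h) v w h

theorem MSep.comap {f : U → V} (hf : f.Injective) {A B : U} (hAB : A ≠ B) {Z : Set V}
    (h : G.MSep (f A) (f B) Z) : (G.comap f).MSep A B (f ⁻¹' Z) := by
  by_contra hn
  obtain ⟨a, b, t⟩ := exists_trail_of_not_mSep hAB hn
  refine not_mSep_of_trail (t.map f (fun u v e => ⟨fun he => e.1 (hf he), e.2⟩) ?_) h
  rintro u v w ⟨⟨y, hy, hv⟩, hZ⟩
  refine ⟨⟨f y, ?_, hv.of_comap⟩, hZ⟩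
  rcases hy with hy | rfl | rfl
  · exact Or.inl hy
  · simp
  · simp

theorem IsMAG.comap {f : U → V} (hf : f.Injective) (h : G.IsMAG) : (G.comap f).IsMAG := by
  refine ⟨⟨fun X Y hd ha => h.1.1 _ _ hd ha.of_comap, fun X Y hb ha => h.1.2 _ _ hb ha.of_comap⟩,
    fun X Y hXY hn => ?_⟩
  obtain ⟨Z, hX, hY, hZ⟩ := h.2 (f X) (f Y) (hf.ne hXY) hn
  exact ⟨f ⁻¹' Z, hX, hY, hZ.comap hf hXY⟩

theorem mSep_comap_equiv (e : U ≃ V) {A B : U} (hAB : A ≠ B) {Z : Set U} :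
    (G.comap e).MSep A B Z ↔ G.MSep (e A) (e B) (e '' Z) := by
  constructor
  · intro h
    have h' : (G.comap e).MSep (e.symm (e A)) (e.symm (e B)) Z := by simpa using h
    have := h'.comap e.symm.injective (e.injective.ne hAB)
    rw [← Equiv.image_eq_preimage_symm] at this
    have hG : (G.comap e).comap e.symm = G := by simp [MixedGraph.comap]
    rwa [hG] at this
  · intro h
    have := h.comap e.injective hAB
    rwa [Set.preimage_image_eq _ e.injective] at this

theorem MarkovEquivalent.comap_equiv {G₁ G₂ : MixedGraph V} (h : G₁.MarkovEquivalent G₂)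
    (e : U ≃ V) : (G₁.comap e).MarkovEquivalent (G₂.comap e) := by
  intro X Y hXY Z hX hY
  rw [mSep_comap_equiv e hXY, mSep_comap_equiv e hXY]
  exact h _ _ (e.injective.ne hXY) _ (by simpa using hX) (by simpa using hY)

end Comap

/-! ### Eliminating a vertex from an open trail -/

section Elimination

variable {V : Type*} {G : MixedGraph V} {X : V}

/-- Any two distinct non-neighbors other than `X` are m-separated by a set avoiding `X`. -/
def SeparableAvoiding (G : MixedGraph V) (X : V) : Prop :=
  ∀ C D, C ≠ X → D ≠ X → C ≠ D → ¬ G.Neighbor C D →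
    ∃ S : Set V, X ∉ S ∧ C ∉ S ∧ D ∉ S ∧ G.MSep C D S

/-- An inducing walk relative to `X` from `C` to `D`, with second vertex `c` and last but one
vertex `d`: its inner vertices are ancestors of `C` or `D`, and are colliders unless equal
to `X`. -/
abbrev Inducing (G : MixedGraph V) (X C c d D : V) : Prop :=
  G.Trail (G.OpenAt (G.anc {C, D}) {X}ᶜ) C c d D

theorem SeparableAvoiding.neighbor (h : G.SeparableAvoiding X) {C c d D : V} (hC : C ≠ X)
    (hD : D ≠ X) (hCD : C ≠ D) (t : G.Inducing X C c d D) : G.Neighbor C D := by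
  by_contra hn
  obtain ⟨S, hX, -, -, hS⟩ := h C D hC hD hCD hn
  refine not_mSep_of_trail (t.mono fun u v w => OpenAt.mono (anc_mono Set.subset_union_right) ?_) hS
  rintro s hs rfl
  exact hX hs

/-- A passage through `X` one of whose two edges leaves `X` is an inducing walk. -/
theorem inducing_through {u w : V} (hu : G.skeleton.Adj u X) (hw : G.skeleton.Adj X w)
    (h : G.dir X u ∨ G.dir X w) : G.Inducing X u X X w := by
  refine .snoc (.edge hu) ⟨?_, fun _ hX => hX rfl⟩ hw
  rcases h with h | h
  · exact ⟨u, by simp, .single h⟩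
  · exact ⟨w, by simp, .single h⟩

theorem SeparableAvoiding.dir_of_dir_of_dir (hG : G.IsAncestral) (h : G.SeparableAvoiding X)
    {u w : V} (hu : G.dir u X) (hw : G.dir X w) : G.dir u w := by
  have huX : u ≠ X := by rintro rfl; exact hG.1 _ _ hu .refl
  have hwX : w ≠ X := by rintro rfl; exact hG.1 _ _ hw .refl
  have huw : u ≠ w := by rintro rfl; exact hG.1 _ _ hu (.single hw)
  have hanc : G.IsAncestor u w := .head hu (.single hw)
  rcases h.neighbor huX hwX huw
    (inducing_through ⟨huX, Or.inl hu⟩ ⟨hwX.symm, Or.inl hw⟩ (Or.inr hw)) with h | h | h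
  · exact h
  · exact absurd hanc (hG.1 _ _ h)
  · exact absurd hanc (hG.2 _ _ (G.bidir_symm _ _ h))

/-- Ancestral relations between the other vertices survive the removal of `X`. -/
theorem SeparableAvoiding.isAncestor_induce (hG : G.IsAncestral) (h : G.SeparableAvoiding X)
    {u w : V} (ha : G.IsAncestor u w) (hu : u ≠ X) (hw : w ≠ X) :
    (G.induce {X}ᶜ).IsAncestor ⟨u, hu⟩ ⟨w, hw⟩ := by
  -- a directed path which has just entered `X` is replaced by arrows to all children of `X`
  have key : ∀ v, G.IsAncestor u v →
      (∀ hv : v ≠ X, (G.induce {X}ᶜ).IsAncestor ⟨u, hu⟩ ⟨v, hv⟩) ∧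
      (v = X → ∀ w (hw : w ≠ X), G.dir X w → (G.induce {X}ᶜ).IsAncestor ⟨u, hu⟩ ⟨w, hw⟩) := by
    intro v hv
    induction hv with
    | refl => exact ⟨fun _ => .refl, fun h => absurd h hu⟩
    | @tail b c _ hbc ih =>
      constructor
      · intro hc
        by_cases hb : b = X
        · exact ih.2 hb c hc (hb ▸ hbc)
        · exact (ih.1 hb).tail hbc
      · rintro rfl w hw hcw
        have hb : b ≠ c := by rintro rfl; exact hG.1 _ _ hbc .refl
        exact (ih.1 hb).tail (h.dir_of_dir_of_dir hG hbc hcw)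
  exact (key w ha).1 hw

/-- Sequences of inducing walks from `A` to `v` between vertices other than `X`. If `s` is
`some (u, b)`, then the last of these walks leads from `u` to `v` and enters `v` from `b`; if `s` is
`none`, then the sequence is empty. Where two of the walks meet, the vertex is passable on the
concatenated walk, and it lies outside `Z` if it is an ancestor of one of the two vertices next to
it in the sequence, so that it will also be passable once the walks are replaced by edges. -/
inductive SegmentChain (G : MixedGraph V) (M Z : Set V) (X A : V) : V → Option (V × V) → Prop
  | nil : SegmentChain G M Z X A A none
  | snoc {v c d w : V} {s : Option (V × V)} : SegmentChain G M Z X A v s →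
      v ≠ w → w ≠ X → G.Inducing X v c d w →
      (∀ u b, s = some (u, b) → G.OpenAt M Z b v c) →
      (∀ u b, s = some (u, b) → v ∈ Z → ¬ G.IsAncestor v u ∧ ¬ G.IsAncestor v w) →
      SegmentChain G M Z X A w (some (v, d))

variable {M Z : Set V} {A : V}

/-- An inducing walk that continues a chain at a passable vertex can be absorbed, by merging it
with as many of the last walks of the chain as needed. All further continuations
remain possible. -/
theorem SegmentChain.hop {v : V} {s : Option (V × V)} (hs : G.SegmentChain M Z X A v s)
    {c d w : V} (hw : w ≠ X) (t : G.Inducing X v c d w)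
    (hok : ∀ u b, s = some (u, b) → G.OpenAt M Z b v c) :
    ∃ s', G.SegmentChain M Z X A w s' ∧
      ∀ f, G.OpenAt M Z d w f → ∀ u b, s' = some (u, b) → G.OpenAt M Z b w f := by
  induction hs generalizing c d w with
  | nil =>
    by_cases hvw : A = w
    · subst hvw
      exact ⟨none, .nil, by simp⟩
    · refine ⟨_, .snoc .nil hvw hw t (by simp) (by simp), ?_⟩
      rintro f hf u b ⟨⟩
      exact hf
  | @snoc u a b v s₀ h₀ huv hv t₀ hok₀ hgood₀ ih =>
    have hb : G.OpenAt M Z b v c := hok _ _ rfl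
    by_cases hvw : v = w
    · subst hvw
      refine ⟨_, .snoc h₀ huv hv t₀ hok₀ hgood₀, ?_⟩
      rintro f hf u b ⟨⟩
      exact hb.cut hf
    by_cases hgood : v ∈ Z → ¬ G.IsAncestor v u ∧ ¬ G.IsAncestor v w
    · refine ⟨_, .snoc (.snoc h₀ huv hv t₀ hok₀ hgood₀) hvw hw t hok ?_, ?_⟩
      · rintro u b ⟨⟩
        exact hgood
      · rintro f hf u b ⟨⟩
        exact hf
    · -- `v` is a collider in `Z` and an ancestor of `u` or `w`, so the last two walks merge
      rw [Classical.not_imp, not_and_or, not_not, not_not] at hgood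
      have hcol : G.IsCollider b v c := by
        by_contra hc
        exact hb.2 hc hgood.1
      have hvanc : v ∈ G.anc {u, w} := by
        rcases hgood.2 with h | h
        · exact ⟨u, by simp, h⟩
        · exact ⟨w, by simp, h⟩
      have hu' : u ∈ G.anc {u, w} := subset_anc _ (by simp)
      have hw' : w ∈ G.anc {u, w} := subset_anc _ (by simp)
      have h₁ : G.anc {u, v} ⊆ G.anc {u, w} := by
        rintro x ⟨y, rfl | rfl, hx⟩
        · exact mem_anc_of_isAncestor hx hu'
        · exact mem_anc_of_isAncestor hx hvanc
      have h₂ : G.anc {v, w} ⊆ G.anc {u, w} := by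
        rintro x ⟨y, rfl | rfl, hx⟩
        · exact mem_anc_of_isAncestor hx hvanc
        · exact mem_anc_of_isAncestor hx hw'
      have hmerge : G.Inducing X u a d w :=
        (t₀.mono fun _ _ _ => OpenAt.mono h₁ subset_rfl).append
          (t.mono fun _ _ _ => OpenAt.mono h₂ subset_rfl) ⟨hvanc, fun hc => absurd hcol hc⟩
      exact ih hw hmerge hok₀

/-- The decomposition of an open trail into inducing walks. At `X` itself, the statement
is about the vertex before `X`. -/
theorem Trail.segmentChain {S : Set V} (hG : G.IsAncestral) (hA : A ≠ X) (hXS : X ∉ S)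
    {c d w : V} (t : G.Trail (G.OpenAt (G.anc S) Z) A c d w) :
    (w ≠ X → ∃ s, G.SegmentChain (G.anc S) Z X A w s ∧
      ∀ f, G.OpenAt (G.anc S) Z d w f → ∀ u b, s = some (u, b) → G.OpenAt (G.anc S) Z b w f) ∧
    (w = X → d ≠ X ∧ G.skeleton.Adj d X ∧ ∃ s, G.SegmentChain (G.anc S) Z X A d s ∧
      ∀ u b, s = some (u, b) → G.OpenAt (G.anc S) Z b d X) := by
  induction t with
  | edge e =>
    refine ⟨fun hw => SegmentChain.nil.hop hw (.edge e) (by simp), ?_⟩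
    rintro rfl
    exact ⟨hA, e, none, .nil, by simp⟩
  | @snoc d w x _ hP e ih =>
    constructor
    · intro hx
      by_cases hw : w = X
      · subst hw
        obtain ⟨hd, had, s, hs, hok⟩ := ih.2 rfl
        by_cases hc : G.IsCollider d w x
        · obtain ⟨z, hz, hwz⟩ := hP.1
          rcases Relation.ReflTransGen.cases_head hwz with rfl | ⟨y, hwy, hyz⟩
          · exact absurd hz hXS
          have hyw : y ≠ w := by rintro rfl; exact hG.1 _ _ hwy .refl
          have hadj : G.skeleton.Adj w y := ⟨hyw.symm, Or.inl hwy⟩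
          obtain ⟨s₁, hs₁, hok₁⟩ := hs.hop hyw (inducing_through had hadj (Or.inr hwy)) hok
          exact hs₁.hop hx (inducing_through hadj.symm e (Or.inl hwy))
            (hok₁ w ⟨⟨z, hz, hyz⟩, fun hc => absurd ⟨Or.inl hwy, Or.inl hwy⟩ hc⟩)
        · refine hs.hop hx (inducing_through had e ?_) hok
          rcases not_and_or.1 hc with h | h
          · exact Or.inl (dir_of_not_arrowInto had h)
          · exact Or.inr (dir_of_not_arrowInto e.symm h)
      · obtain ⟨s, hs, hok⟩ := ih.1 hw
        exact hs.hop hx (.edge e) (hok x hP)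
    · rintro rfl
      obtain ⟨s, hs, hok⟩ := ih.1 e.ne
      exact ⟨e.ne, e, s, hs, hok x hP⟩

/-- The edges between the successive endpoints of the inducing walks in a chain form an open trail
avoiding `X`. -/
theorem SegmentChain.trail_induce {S : Set V} (hG : G.IsAncestral) (h : G.SeparableAvoiding X)
    (hA : A ≠ X) (hXS : X ∉ S) {v : V} {s : Option (V × V)}
    (hs : G.SegmentChain (G.anc S) Z X A v s) :
    ∃ hv : v ≠ X, (s = none → v = A) ∧ ∀ u b, s = some (u, b) → ∃ (hu : u ≠ X) (c : _),
      (G.induce {X}ᶜ).Trail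
        ((G.induce {X}ᶜ).OpenAt ((G.induce {X}ᶜ).anc (Subtype.val ⁻¹' S)) (Subtype.val ⁻¹' Z))
        ⟨A, hA⟩ c ⟨u, hu⟩ ⟨v, hv⟩ := by
  induction hs with
  | nil => exact ⟨hA, fun _ => rfl, by simp⟩
  | @snoc v c d w s h₀ hvw hw t hok hgood ih =>
    obtain ⟨hv, hnil, hcons⟩ := ih
    have hadj : (G.induce {X}ᶜ).skeleton.Adj ⟨v, hv⟩ ⟨w, hw⟩ :=
      ⟨fun he => hvw (congrArg Subtype.val he), h.neighbor hv hw hvw t⟩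
    refine ⟨hw, by simp, ?_⟩
    rintro _ _ ⟨⟩
    refine ⟨hv, ?_⟩
    cases s with
    | none =>
      obtain rfl := hnil rfl
      exact ⟨_, .edge hadj⟩
    | some p =>
      obtain ⟨u, b⟩ := p
      obtain ⟨hu, a, tr⟩ := hcons u b rfl
      have hadj₀ : (G.induce {X}ᶜ).skeleton.Adj ⟨u, hu⟩ ⟨v, hv⟩ := by
        cases tr with
        | edge e => exact e
        | snoc _ _ e => exact e
      refine ⟨a, tr.snoc ⟨?_, fun hc hz => ?_⟩ hadj⟩
      · obtain ⟨z, hz, hvz⟩ := (hok u b rfl).1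
        have hzX : z ≠ X := by rintro rfl; exact hXS hz
        exact ⟨⟨z, hzX⟩, hz, h.isAncestor_induce hG hvz hv hzX⟩
      · obtain ⟨h₁, h₂⟩ := hgood u b rfl hz
        rcases not_and_or.1 hc with hn | hn
        · exact h₁ (.single (dir_of_not_arrowInto (G := G.induce {X}ᶜ) hadj₀ hn))
        · exact h₂ (.single (dir_of_not_arrowInto (G := G.induce {X}ᶜ) hadj.symm hn))

theorem SeparableAvoiding.isRemovable (hG : G.IsAncestral) (h : G.SeparableAvoiding X) :
    G.IsRemovable X := by
  intro Y T hYT Z hY hT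
  constructor
  · intro hsep
    have := MSep.comap (f := (Subtype.val : ({X}ᶜ : Set V) → V)) Subtype.val_injective hYT hsep
    rwa [Set.preimage_image_eq _ Subtype.val_injective] at this
  · intro hsep
    by_contra hn
    have hYT' : (Y : V) ≠ T := Subtype.val_injective.ne hYT
    obtain ⟨c, d, t⟩ := exists_trail_of_not_mSep hYT' hn
    have hXS : X ∉ Subtype.val '' Z ∪ {(Y : V), (T : V)} := by
      rintro (⟨z, -, hz⟩ | hz | hz)
      · exact z.2 hz
      · exact Y.2 hz.symm
      · exact T.2 hz.symm
    obtain ⟨s, hs, -⟩ := (t.segmentChain hG Y.2 hXS).1 T.2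
    obtain ⟨_, hnil, hcons⟩ := hs.trail_induce hG h Y.2 hXS
    cases s with
    | none => exact hYT' (hnil rfl).symm
    | some p =>
      obtain ⟨hu, a, tr⟩ := hcons p.1 p.2 rfl
      refine not_mSep_of_trail (tr.mono fun _ _ _ => OpenAt.mono (anc_mono ?_) ?_) hsep
      · rintro z (⟨z', hz', he⟩ | hz | hz)
        · exact Or.inl (Subtype.val_injective he ▸ hz')
        · exact Or.inr (Or.inl (Subtype.val_injective hz))
        · exact Or.inr (Or.inr (Subtype.val_injective hz))
      · exact fun z hz => ⟨z, hz, rfl⟩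

end Elimination

/-! ### Markov equivalence, removable vertices and r-orders -/

section Removable

variable {V : Type*} {G G₁ G₂ : MixedGraph V} {X : V}

theorem isRemovable_iff_separable (hG : G.IsMAG) : G.IsRemovable X ↔ G.SeparableAvoiding X := by
  refine ⟨fun h C D hC hD hCD hn => ?_, fun h => h.isRemovable hG.1⟩
  have hCD' : (⟨C, hC⟩ : ({X}ᶜ : Set V)) ≠ ⟨D, hD⟩ := fun he => hCD (congrArg Subtype.val he)
  obtain ⟨Z, hCZ, hDZ, hZ⟩ :=
    (hG.comap (f := (Subtype.val : ({X}ᶜ : Set V) → V)) Subtype.val_injective).2 _ _ hCD' hn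
  refine ⟨Subtype.val '' Z, ?_, ?_, ?_, (h _ _ hCD' Z hCZ hDZ).2 hZ⟩
  · rintro ⟨z, -, hz⟩
    exact z.2 hz
  · simpa [hC] using hCZ
  · simpa [hD] using hDZ

theorem IsMAG.neighbor_iff (hG : G.IsMAG) {C D : V} (hCD : C ≠ D) :
    G.Neighbor C D ↔ ∀ Z : Set V, C ∉ Z → D ∉ Z → ¬ G.MSep C D Z := by
  refine ⟨fun h Z _ _ => not_mSep_of_trail (.edge ⟨hCD, h⟩), fun h => ?_⟩
  by_contra hn
  obtain ⟨Z, hC, hD, hZ⟩ := hG.2 C D hCD hn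
  exact h Z hC hD hZ

theorem MarkovEquivalent.symm (h : G₁.MarkovEquivalent G₂) : G₂.MarkovEquivalent G₁ :=
  fun X Y hXY Z hX hY => (h X Y hXY Z hX hY).symm

theorem SeparableAvoiding.of_markovEquivalent (h₁ : G₁.IsMAG) (h₂ : G₂.IsMAG)
    (h : G₁.MarkovEquivalent G₂) (hX : G₁.SeparableAvoiding X) : G₂.SeparableAvoiding X := by
  intro C D hC hD hCD hn
  have hn₁ : ¬ G₁.Neighbor C D := by
    rw [h₁.neighbor_iff hCD]
    rw [h₂.neighbor_iff hCD] at hn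
    exact fun hs => hn fun Z hCZ hDZ hZ => hs Z hCZ hDZ ((h C D hCD Z hCZ hDZ).2 hZ)
  obtain ⟨S, hXS, hCS, hDS, hS⟩ := hX C D hC hD hCD hn₁
  exact ⟨S, hXS, hCS, hDS, (h C D hCD S hCS hDS).1 hS⟩

theorem IsRemovable.of_markovEquivalent (h₁ : G₁.IsMAG) (h₂ : G₂.IsMAG)
    (h : G₁.MarkovEquivalent G₂) (hX : G₁.IsRemovable X) : G₂.IsRemovable X :=
  (isRemovable_iff_separable h₂).2
    (((isRemovable_iff_separable h₁).1 hX).of_markovEquivalent h₁ h₂ h)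

theorem MarkovEquivalent.induce_compl (h : G₁.MarkovEquivalent G₂) (hX₁ : G₁.IsRemovable X)
    (hX₂ : G₂.IsRemovable X) : (G₁.induce {X}ᶜ).MarkovEquivalent (G₂.induce {X}ᶜ) := by
  intro Y T hYT Z hY hT
  rw [← hX₁ Y T hYT Z hY hT, ← hX₂ Y T hYT Z hY hT]
  exact h _ _ (Subtype.val_injective.ne hYT) _
    (by rwa [Subtype.val_injective.mem_set_image]) (by rwa [Subtype.val_injective.mem_set_image])

theorem IsMAG.induce (h : G.IsMAG) (W : Set V) : (G.induce W).IsMAG :=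
  h.comap (f := (Subtype.val : W → V)) Subtype.val_injective

theorem rOrders_subset_of_markovEquivalent (h₁ : G₁.IsMAG) (h₂ : G₂.IsMAG)
    (h : G₁.MarkovEquivalent G₂) : G₁.rOrders ⊆ G₂.rOrders := by
  intro π hπ
  let W : ℕ → Set V := fun k => {v | ∃ j : Fin (Nat.card V), k ≤ (j : ℕ) ∧ π j = v}
  have key : ∀ k, k ≤ Nat.card V → (G₁.induce (W k)).MarkovEquivalent (G₂.induce (W k)) := by
    intro k
    induction k with
    | zero =>
      intro _
      have hW : ∀ v, v ∈ W 0 := fun v => ⟨π.symm v, Nat.zero_le _, π.apply_symm_apply v⟩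
      exact h.comap_equiv (Equiv.subtypeUnivEquiv hW)
    | succ k ih =>
      intro hk
      let i : Fin (Nat.card V) := ⟨k, hk⟩
      have hi := ih (Nat.le_of_succ_le hk)
      let x : W k := ⟨π i, i, le_rfl, rfl⟩
      have hx₁ : (G₁.induce (W k)).IsRemovable x := hπ i
      have hx₂ := hx₁.of_markovEquivalent (h₁.induce _) (h₂.induce _) hi
      -- the vertices after `x` in the order, as a subset of `W k` without `x`
      let e : W (k + 1) ≃ ({x}ᶜ : Set (W k)) :=
        { toFun := fun v => ⟨⟨v.1, by
              obtain ⟨j, hj, hv⟩ := v.2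
              exact ⟨j, Nat.le_of_succ_le hj, hv⟩⟩, by
            obtain ⟨_, j, hj, rfl⟩ := v
            intro he
            have : π j = π i := congrArg Subtype.val he
            have := π.injective this
            subst this
            exact absurd hj (Nat.not_succ_le_self k)⟩
          invFun := fun v => ⟨v.1.1, by
            obtain ⟨⟨_, j, hj, rfl⟩, hv⟩ := v
            refine ⟨j, lt_of_le_of_ne hj ?_, rfl⟩
            rintro rfl
            exact hv rfl⟩
          left_inv := fun _ => rfl
          right_inv := fun _ => rfl }
      exact (hi.induce_compl hx₁ hx₂).comap_equiv e
  exact fun i => (hπ i).of_markovEquivalent (h₁.induce _) (h₂.induce _) (key i i.2.le)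

theorem removables_subset_of_markovEquivalent (h₁ : G₁.IsMAG) (h₂ : G₂.IsMAG)
    (h : G₁.MarkovEquivalent G₂) : G₁.removables ⊆ G₂.removables :=
  fun _ hX => hX.of_markovEquivalent h₁ h₂ h

end Removable

end MixedGraph

theorem mainTheorem12 {V : Type*} [Finite V] (G₁ G₂ : MixedGraph V)
    (h₁ : G₁.IsMAG) (h₂ : G₂.IsMAG) (h : G₁.MarkovEquivalent G₂) :
    G₁.removables = G₂.removables ∧ G₁.rOrders = G₂.rOrders :=
  ⟨(MixedGraph.removables_subset_of_markovEquivalent h₁ h₂ h).antisymm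
      (MixedGraph.removables_subset_of_markovEquivalent h₂ h₁ h.symm),
    (MixedGraph.rOrders_subset_of_markovEquivalent h₁ h₂ h).antisymm
      (MixedGraph.rOrders_subset_of_markovEquivalent h₂ h₁ h.symm)⟩
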